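/- **Theorem 4.** Consider the following game between Learner and Nature with $K$ experts and $T$ rounds. At the start of each round $t=1,\dots,T$, Nature reveals a nonempty set $E_a^t$ of available experts, where $E_a^1$ is the set of all $K$ experts and $E_a^{t+1}\subseteq E_a^t$ (an expert that has died never returns); Learner then chooses a probability vector $\mathbf p_t$ supported on $E_a^t$, depending only on $E_a^1,\dots,E_a^t$ and on the past loss vectors (Learner does not know the order in which experts will die); then Nature reveals a loss vector $\boldsymbol\ell_t\in[0,1]^K$, and Learner suffers $\mathbf p_t\cdot\boldsymbol\ell_t$. A round $t<T$ is a night if $E_a^{t+1}\neq E_a^t$. For an ordering $\pi$ of the experts let $\sigma^t(\pi)$ be the first expert of $\pi$ that lies in $E_a^t$. The ranking regret is $$R_\Pi(1,T)=\sum_{t=1}^T \mathbf p_t\cdot\boldsymbol\ell_t-\min_{\pi}\sum_{t=1}^T \ell_{\sigma^t(\pi),t},$$ the minimum being over all orderings of the $K$ experts. Let $V(K,T,m)$ be the minimax ranking regret: the infimum over Learner's strategies (which may depend on $K,T,m$) of the supremum of $R_\Pi(1,T)$ over all choices of Nature with exactly $m$ nights. There is a universal constant $c>0$ such that for all integers $m\ge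 0$, $K\ge m+1$ and $T\ge m+1$, $$V(K,T,m)\ \ge\ c\,\min\bigl\{\sqrt{mT\log K},\;T\bigr\}.$$ Moreover, writing $T'=T/(m+1)$ for the average length of a day, if $\sqrt{(T'/2)\log K}<T'$ then $$V(K,T,m)\ \ge\ c\,\sqrt{mT\log K},$$ that is, the minimax ranking regret is $\Omega(\sqrt{mT\log K})$. -/

import Mathlib

namespace DyingExperts

noncomputable section

/-- The choices of Nature. Rounds are numbered `0, 1, 2, …`; a game of `T` rounds uses the rounds
`t < T` only, and what is prescribed for later rounds is irrelevant (every `T`-round play extends,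
for example by keeping the set of alive experts constant). All experts are alive at the start,
the nonempty set of alive experts can only shrink, and losses lie in `[0, 1]`. -/
structure Play (K : ℕ) where
  /-- the set of experts available in round `t` -/
  alive : ℕ → Finset (Fin K)
  /-- the loss vector of round `t` -/
  loss : ℕ → Fin K → ℝ
  alive_zero : alive 0 = Finset.univ
  alive_nonempty : ∀ t, (alive t).Nonempty
  alive_succ_subset : ∀ t, alive (t + 1) ⊆ alive t
  loss_mem : ∀ t i, loss t i ∈ Set.Icc (0 : ℝ) 1

/-- The nights of a game of `T` rounds: the rounds `t` such that some expert
becomes unavailable in round `t + 1`, which is still a round of the game. -/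
def Play.nights {K : ℕ} (P : Play K) (T : ℕ) : Finset ℕ :=
  {t ∈ Finset.range T | t + 1 < T ∧ P.alive (t + 1) ≠ P.alive t}

/-- What has been revealed before round `t`, apart from the set of experts available in round `t`:
the sets of available experts and the loss vectors of the rounds `0, …, t - 1`. -/
def Play.history {K : ℕ} (P : Play K) (t : ℕ) : List (Finset (Fin K) × (Fin K → ℝ)) :=
  (List.range t).map fun s => (P.alive s, P.loss s)

/-- A strategy of Learner who does not know the order of dying: the probability vector of a round
is a function of the past rounds and of the set `A` of currently available experts only,
and it is supported on `A`. -/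
structure Strategy (K : ℕ) where
  predict : List (Finset (Fin K) × (Fin K → ℝ)) → Finset (Fin K) → Fin K → ℝ
  predict_mem : ∀ h A, A.Nonempty → predict h A ∈ stdSimplex ℝ (Fin K)
  predict_support : ∀ h A, A.Nonempty → ∀ i, i ∉ A → predict h A i = 0

/-- The loss `p_t · ℓ_t` suffered by Learner in round `t`. -/
def Strategy.roundLoss {K : ℕ} (S : Strategy K) (P : Play K) (t : ℕ) : ℝ :=
  ∑ i, S.predict (P.history t) (P.alive t) i * P.loss t i

/-- The first expert of the ordering `π 0, π 1, …, π (K - 1)` that lies in `A`. -/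
def firstAlive {K : ℕ} (π : Equiv.Perm (Fin K)) (A : Finset (Fin K)) (hA : A.Nonempty) : Fin K :=
  π ((A.image π.symm).min' (hA.image π.symm))

/-- The cumulative loss of the ordering `π`, which plays its first alive expert in each round. -/
def Play.orderingLoss {K : ℕ} (P : Play K) (T : ℕ) (π : Equiv.Perm (Fin K)) : ℝ :=
  ∑ t ∈ Finset.range T, P.loss t (firstAlive π (P.alive t) (P.alive_nonempty t))

/-- The ranking regret over `T` rounds: the cumulative loss of Learner minus that of the best
ordering of all `K` experts. -/
def rankingRegret {K : ℕ} (S : Strategy K) (P : Play K) (T : ℕ) : ℝ :=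
  ∑ t ∈ Finset.range T, S.roundLoss P t -
    (Finset.univ : Finset (Equiv.Perm (Fin K))).inf' Finset.univ_nonempty (P.orderingLoss T)

/-- The minimax ranking regret, for unknown order of dying, of the game with `K` experts,
`T` rounds and exactly `m` nights: the infimum over the strategies of Learner (which may depend on
`K`, `T`, `m`) of the supremum over the choices of Nature. -/
def minimaxRankingRegret (K T m : ℕ) : EReal :=
  ⨅ S : Strategy K, ⨆ P : {P : Play K // (P.nights T).card = m}, (rankingRegret S P.1 T : EReal)

end

end DyingExperts

/-!
Nature plays `m + 1` days, the first `m` of length `k * N`, and every night kills the expert that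
was best on the day that has just ended. The ordering that lists the experts by time of death
therefore follows the best expert of every day (`exists_ordering`), so the regrets of the single
days add up.

On each of the first `D ≈ m / 2` days at least `2 ^ k` experts are alive, where `k ≈ log K` unless
the days are too short, and the alive experts are labelled with codes of `k` bits such that all
codes occur. A day is divided into `k` blocks of `N` rounds. In the `j`-th block only the `j`-th bit
of the code matters: Nature chooses a sign `ε t` in round `t`, the experts whose bit agrees with it
lose `1`, the others `0`. An expert that has the better bit in each of the `k` blocks gains
`|∑ ε t| / 2` over the average loss `1 / 2` per round in each of them. For random signs, Learner
loses `1 / 2` per round on average, while `𝔼 |∑ ε t| ≥ c √N` in each block; hence the regret is of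
order `D * k * √N`. This replaces estimates for the maximum of many independent random walks by the
second and fourth moments of a single one.

The expectation is derandomized in `exists_signs`: against any adapted sequence of weights, the
signs can be chosen round by round so as not to decrease a `potential` built from
`|x| ≥ (12 N x ^ 2 - x ^ 4) / (16 N ^ (3 / 2))`. With `k ≈ min (log K) (T / m)` and
`k * N ≈ T / m`, the order `D * k * √N` is `min √(m T log K) T`. The last bound of the theorem
follows from the first, because its hypothesis forces `√(m T log K) ≤ 2 T`.
-/

namespace DyingExperts

open Finset

noncomputable section

/-! ### Choosing signs against an adapted sequence of weights -/

/-- The real sign of a bit: `1` for `true`, `-1` for `false`. -/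
def sgn (b : Bool) : ℝ := if b then 1 else -1

lemma ite_eq_eq_sgn (b c : Bool) :
    (if b = c then 1 else 0 : ℝ) = 1 / 2 + 1 / 2 * (sgn b * sgn c) := by
  cases b <;> cases c <;> norm_num [sgn]

lemma sum_range_mul_eq (f : ℕ → ℝ) (B N : ℕ) :
    ∑ t ∈ range (B * N), f t = ∑ b ∈ range B, ∑ r ∈ range N, f (b * N + r) := by
  induction B with
  | zero => simp
  | succ B ih => rw [Nat.succ_mul, sum_range_add, sum_range_succ, ih]

/-- The expectation of `(12 * N * Y ^ 2 - Y ^ 4) / (16 * N ^ (3 / 2))`, a lower bound of `|Y|`, where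
`Y` is the endpoint of a simple random walk that starts at `x` and makes `r` steps. -/
def potential (N x r : ℝ) : ℝ :=
  (12 * N * (x ^ 2 + r) - (x ^ 4 + 6 * x ^ 2 * r + 3 * r ^ 2 - 2 * r)) / (16 * √N ^ 3)

/-- The martingale property of the potential. -/
lemma potential_add_potential (N x r : ℝ) :
    potential N (x + 1) r + potential N (x - 1) r = 2 * potential N x (r + 1) := by
  unfold potential
  ring

lemma le_potential_zero {N : ℝ} (hN : 0 < N) : 9 / 16 * √N ≤ potential N 0 N := by
  have hs := Real.sqrt_pos.2 hN
  have hsq : √N ^ 2 = N := Real.sq_sqrt hN.le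
  unfold potential
  rw [le_div_iff₀ (by positivity)]
  have : 9 / 16 * √N * (16 * √N ^ 3) = 9 * (√N ^ 2) ^ 2 := by ring
  rw [this, hsq]
  nlinarith

lemma potential_zero_le {N : ℝ} (hN : 0 < N) (x : ℝ) : potential N x 0 ≤ |x| := by
  have hs := Real.sqrt_pos.2 hN
  have hsq : √N ^ 2 = N := Real.sq_sqrt hN.le
  unfold potential
  rw [div_le_iff₀ (by positivity)]
  have h2 : x ^ 2 = |x| ^ 2 := (sq_abs x).symm
  have h4 : x ^ 4 = |x| ^ 4 := by rw [← Even.pow_abs (by decide : Even 4)]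
  rw [h2, h4]
  have hx := abs_nonneg x
  generalize |x| = y at *
  generalize √N = s at *
  subst hsq
  -- the quartic bound touches `y` at `y = 2 * s`
  have : 0 ≤ y * ((y - 2 * s) ^ 2 * (y + 4 * s)) := by positivity
  nlinarith

/-- Against weights `q t` that depend only on the signs before round `t`, the signs of a block of
`N` rounds can be chosen such that the weighted sum plus the modulus of the plain sum is at least
of order `√N`. -/
lemma exists_signs_block (q : ℕ → (ℕ → Bool) → ℝ)
    (hq : ∀ t ε ε', (∀ s < t, ε s = ε' s) → q t ε = q t ε') {N : ℕ} (hN : 0 < N)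
    (ε₀ : ℕ → Bool) (s : ℕ) :
    ∃ ε : ℕ → Bool, (∀ t < s, ε t = ε₀ t) ∧
      9 / 16 * √N ≤ ∑ r ∈ range N, sgn (ε (s + r)) * q (s + r) ε +
        |∑ r ∈ range N, sgn (ε (s + r))| := by
  have hN' : (0 : ℝ) < N := by exact_mod_cast hN
  suffices H : ∀ n : ℕ, n ≤ N → ∃ ε : ℕ → Bool, (∀ t < s, ε t = ε₀ t) ∧
      9 / 16 * √N ≤ ∑ r ∈ range n, sgn (ε (s + r)) * q (s + r) ε +
        potential N (∑ r ∈ range n, sgn (ε (s + r))) ((N - n : ℕ) : ℝ) by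
    obtain ⟨ε, h1, h2⟩ := H N le_rfl
    refine ⟨ε, h1, h2.trans ?_⟩
    rw [Nat.sub_self, Nat.cast_zero]
    gcongr
    exact potential_zero_le hN' _
  intro n
  induction n with
  | zero => exact fun _ => ⟨ε₀, fun _ _ => rfl, by simpa using le_potential_zero hN'⟩
  | succ n ih =>
    intro hn
    obtain ⟨ε, h1, h2⟩ := ih (by lia)
    have agree : ∀ b, ∀ t < s + n, Function.update ε (s + n) b t = ε t := fun b t ht =>
      Function.update_of_ne ht.ne _ _
    have key : ∀ b, ∑ r ∈ range (n + 1), sgn (Function.update ε (s + n) b (s + r)) *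
          q (s + r) (Function.update ε (s + n) b) +
        potential N (∑ r ∈ range (n + 1), sgn (Function.update ε (s + n) b (s + r)))
          ((N - (n + 1) : ℕ) : ℝ) =
        ∑ r ∈ range n, sgn (ε (s + r)) * q (s + r) ε + sgn b * q (s + n) ε +
        potential N (∑ r ∈ range n, sgn (ε (s + r)) + sgn b) ((N - (n + 1) : ℕ) : ℝ) := by
      intro b
      have e1 : ∀ r ∈ range n, sgn (Function.update ε (s + n) b (s + r)) = sgn (ε (s + r)) :=
        fun r hr => by rw [agree b _ (by have := mem_range.1 hr; lia)]
      have e2 : ∀ r ≤ n, q (s + r) (Function.update ε (s + n) b) = q (s + r) ε :=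
        fun r hr => hq _ _ _ fun t ht => agree b t (by lia)
      rw [sum_range_succ, sum_range_succ, sum_congr rfl e1, Function.update_self, e2 n le_rfl,
        sum_congr rfl fun r hr => by rw [e1 r hr, e2 r (mem_range.1 hr).le]]
    have hpot := potential_add_potential N (∑ r ∈ range n, sgn (ε (s + r)))
      ((N - (n + 1) : ℕ) : ℝ)
    have hcast : ((N - (n + 1) : ℕ) : ℝ) + 1 = ((N - n : ℕ) : ℝ) := by
      have : N - n = (N - (n + 1)) + 1 := by lia
      rw [this]; push_cast; ring
    rw [hcast] at hpot
    have old : ∀ b, ∀ t < s, Function.update ε (s + n) b t = ε₀ t := fun b t ht =>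
      (agree b t (by lia)).trans (h1 t ht)
    have kt := key true
    have kf := key false
    simp only [sgn, if_true, Bool.false_eq_true, if_false] at kt kf
    -- the two choices of the next sign keep the bound on average, so one of them keeps it
    by_contra! hcon
    have ht := hcon _ (old true)
    have hf := hcon _ (old false)
    simp only [sgn] at ht hf hpot h2
    rw [kt] at ht
    rw [kf, ← sub_eq_add_neg] at hf
    linarith

/-- The signs of `B` consecutive blocks, each chosen as in `exists_signs_block`. -/
theorem exists_signs (q : ℕ → (ℕ → Bool) → ℝ)
    (hq : ∀ t ε ε', (∀ s < t, ε s = ε' s) → q t ε = q t ε') {N : ℕ} (hN : 0 < N) (B : ℕ) :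
    ∃ ε : ℕ → Bool, B * (9 / 16 * √N) ≤ ∑ t ∈ range (B * N), sgn (ε t) * q t ε +
        ∑ b ∈ range B, |∑ r ∈ range N, sgn (ε (b * N + r))| := by
  induction B with
  | zero => exact ⟨fun _ => true, by simp⟩
  | succ B ih =>
    obtain ⟨ε₀, h₀⟩ := ih
    obtain ⟨ε, h1, h2⟩ := exists_signs_block q hq hN ε₀ (B * N)
    refine ⟨ε, ?_⟩
    have e1 : ∑ t ∈ range (B * N), sgn (ε t) * q t ε =
        ∑ t ∈ range (B * N), sgn (ε₀ t) * q t ε₀ := by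
      refine sum_congr rfl fun t ht => ?_
      have ht := mem_range.1 ht
      rw [h1 t ht, hq t ε ε₀ fun s hs => h1 s (hs.trans ht)]
    have e2 : ∑ b ∈ range B, |∑ r ∈ range N, sgn (ε (b * N + r))| =
        ∑ b ∈ range B, |∑ r ∈ range N, sgn (ε₀ (b * N + r))| := by
      refine sum_congr rfl fun b hb => ?_
      congr 1
      refine sum_congr rfl fun r hr => ?_
      have hb := mem_range.1 hb
      have hr := mem_range.1 hr
      rw [h1 _ (by nlinarith)]
    rw [Nat.succ_mul, sum_range_add, sum_range_succ, e1, e2]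
    push_cast
    linarith

/-! ### The play that kills the best expert of each day -/

section Killing

variable {K k : ℕ} (pick : Finset (Fin K) → (Fin k → Bool) → Fin K) (N : ℕ)

/-- The code of the best expert of day `d` under the signs `ε`. An expert with bit `true` in a block
loses more than the average there exactly if the signs of the block have a positive sum. -/
def leaderCode (k N : ℕ) (ε : ℕ → Bool) (d : ℕ) (j : Fin k) : Bool :=
  decide (∑ r ∈ range N, sgn (ε ((d * k + j) * N + r)) < 0)

/-- The experts alive on day `d` if every night kills the best expert of the day before. The
function `pick` selects, from a set of alive experts, one with a given code. -/
def aliveOn (ε : ℕ → Bool) : ℕ → Finset (Fin K)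
  | 0 => univ
  | d + 1 => (aliveOn ε d).erase (pick (aliveOn ε d) (leaderCode k N ε d))

/-- The expert killed in the night after day `d`. -/
def leader (ε : ℕ → Bool) (d : ℕ) : Fin K := pick (aliveOn pick N ε d) (leaderCode k N ε d)

lemma leaderCode_congr {ε ε' : ℕ → Bool} {d : ℕ} (h : ∀ s < (d + 1) * k * N, ε s = ε' s) :
    leaderCode k N ε d = leaderCode k N ε' d := by
  funext j
  unfold leaderCode
  have : ∀ r ∈ range N, sgn (ε ((d * k + j) * N + r)) = sgn (ε' ((d * k + j) * N + r)) := by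
    intro r hr
    have hr := mem_range.1 hr
    have hj : d * k + j + 1 ≤ (d + 1) * k := by
      have := j.2
      rw [add_mul]; lia
    have := Nat.mul_le_mul_right N hj
    rw [h _ (by rw [add_mul _ 1 N] at this; lia)]
  rw [sum_congr rfl this]

lemma aliveOn_congr {ε ε' : ℕ → Bool} {d : ℕ} (h : ∀ s < d * k * N, ε s = ε' s) :
    aliveOn pick N ε d = aliveOn pick N ε' d := by
  induction d with
  | zero => rfl
  | succ d ih =>
    have hle : d * k * N ≤ (d + 1) * k * N := by gcongr; lia
    simp only [aliveOn]
    rw [ih fun s hs => h s (hs.trans_le hle), leaderCode_congr N h]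

lemma aliveOn_antitone (ε : ℕ → Bool) : Antitone (aliveOn pick N ε) :=
  antitone_nat_of_succ_le fun _ => erase_subset _ _

variable {pick}

lemma card_aliveOn (hpick : ∀ A w, A.Nonempty → pick A w ∈ A)
    (ε : ℕ → Bool) {d : ℕ} (hd : d ≤ K) : #(aliveOn pick N ε d) = K - d := by
  induction d with
  | zero => simp [aliveOn]
  | succ d ih =>
    have h := ih (by lia)
    rw [aliveOn, card_erase_of_mem (hpick _ _ (card_pos.1 (by lia))), h]
    lia

lemma aliveOn_nonempty (hpick : ∀ A w, A.Nonempty → pick A w ∈ A)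
    (ε : ℕ → Bool) {d : ℕ} (hd : d < K) : (aliveOn pick N ε d).Nonempty :=
  card_pos.1 (by rw [card_aliveOn N hpick ε hd.le]; lia)

lemma leader_mem (hpick : ∀ A w, A.Nonempty → pick A w ∈ A)
    (ε : ℕ → Bool) {d : ℕ} (hd : d < K) :
    leader pick N ε d ∈ aliveOn pick N ε d :=
  hpick _ _ (aliveOn_nonempty N hpick ε hd)

lemma leader_notMem (ε : ℕ → Bool) {d d' : ℕ} (h : d < d') :
    leader pick N ε d ∉ aliveOn pick N ε d' :=
  fun hmem => notMem_erase _ _ (aliveOn_antitone pick N ε (Nat.succ_le_of_lt h) hmem)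

/-- If the experts are ordered by their time of death, then the first alive expert of each day is
the one that is killed the following night. -/
lemma exists_ordering (hpick : ∀ A w, A.Nonempty → pick A w ∈ A)
    (ε : ℕ → Bool) :
    ∃ π : Equiv.Perm (Fin K), ∀ d < K, ∀ hA : (aliveOn pick N ε d).Nonempty,
      firstAlive π (aliveOn pick N ε d) hA = leader pick N ε d := by
  have hinj : Function.Injective fun d : Fin K => leader pick N ε d := by
    intro a b hab
    replace hab : leader pick N ε a = leader pick N ε b := hab
    by_contra hne
    rcases lt_or_gt_of_ne hne with h | h
    · exact leader_notMem N ε h (hab ▸ leader_mem N hpick ε b.2)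
    · exact leader_notMem N ε h (hab ▸ leader_mem N hpick ε a.2)
  refine ⟨Equiv.ofBijective _ (Finite.injective_iff_bijective.1 hinj), fun d hd hA => ?_⟩
  set π := Equiv.ofBijective _ (Finite.injective_iff_bijective.1 hinj) with hπ
  have hπd : ∀ d : Fin K, π d = leader pick N ε d := fun d => rfl
  suffices h : ((aliveOn pick N ε d).image π.symm).min' (hA.image π.symm) = ⟨d, hd⟩ by
    rw [firstAlive, h, hπd]
  refine le_antisymm (min'_le _ _ (mem_image.2 ⟨_, leader_mem N hpick ε hd, ?_⟩))
    (le_min' _ _ _ fun y hy => ?_)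
  · rw [Equiv.symm_apply_eq, hπd]
  · obtain ⟨x, hx, rfl⟩ := mem_image.1 hy
    by_contra! hlt
    refine leader_notMem (pick := pick) N ε (d := π.symm x) (d' := d) hlt ?_
    rwa [← hπd, Equiv.apply_symm_apply]

variable (hpick : ∀ A w, A.Nonempty → pick A w ∈ A)
  (code : Finset (Fin K) → Fin K → ℕ → Bool) {m : ℕ} (hm : m < K) (D : ℕ)

/-- The play in which the best expert is killed after each of the first `m` days of `k * N` rounds.
In round `t < D * k * N`, in the `t / N`-th block of the game, the experts whose bit number
`t / N % k` agrees with `ε t` lose `1` and the others `0`; later on all losses vanish. The code of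
an expert, given by `code`, depends on the set of alive experts. -/
def killingPlay (ε : ℕ → Bool) : Play K where
  alive t := aliveOn pick N ε (min (t / N / k) m)
  loss t i := if t < D * k * N then
    if code (aliveOn pick N ε (min (t / N / k) m)) i (t / N % k) = ε t then 1 else 0 else 0
  alive_zero := by simp [aliveOn]
  alive_nonempty _ := aliveOn_nonempty N hpick ε (by lia)
  alive_succ_subset t := aliveOn_antitone pick N ε (by gcongr; lia)
  loss_mem t i := by split_ifs <;> simp

/-- The nights are the last rounds `(d + 1) * (N * k) - 1` of the days `d < m`. -/
lemma card_nights_killingPlay (hk : 0 < k) (hN : 0 < N) {T : ℕ} (hT : m * (k * N) < T)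
    (ε : ℕ → Bool) : #((killingPlay N hpick code hm D ε).nights T) = m := by
  have hM : 0 < N * k := by positivity
  have halive : ∀ t, (killingPlay N hpick code hm D ε).alive (t + 1) ≠
      (killingPlay N hpick code hm D ε).alive t ↔
        min ((t + 1) / (N * k)) m ≠ min (t / (N * k)) m := by
    intro t
    refine not_congr ⟨fun h => ?_, fun h => ?_⟩
    · have h := congrArg card h
      simp only [killingPlay, Nat.div_div_eq_div_mul] at h
      rw [card_aliveOn N hpick ε (by lia), card_aliveOn N hpick ε (by lia)] at h
      lia
    · simp only [killingPlay, Nat.div_div_eq_div_mul, h]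
  have himage : (killingPlay N hpick code hm D ε).nights T =
      (range m).image fun d => (d + 1) * (N * k) - 1 := by
    ext t
    simp only [Play.nights, mem_filter, mem_range, mem_image, halive, Nat.succ_div]
    constructor
    · rintro ⟨-, -, h⟩
      split_ifs at h with hdvd
      · refine ⟨t / (N * k), by lia, ?_⟩
        have := Nat.succ_div_of_dvd hdvd
        rw [← this, Nat.div_mul_cancel hdvd]
        lia
      · exact absurd rfl h
    · rintro ⟨d, hd, rfl⟩
      have hpos : 0 < (d + 1) * (N * k) := by positivity
      have e : (d + 1) * (N * k) - 1 + 1 = (d + 1) * (N * k) := by lia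
      have hle : (d + 1) * (N * k) ≤ m * (k * N) := by
        rw [mul_comm N k]; gcongr; lia
      have hdvd : N * k ∣ (d + 1) * (N * k) := dvd_mul_left _ _
      have hdiv : ((d + 1) * (N * k) - 1) / (N * k) = d := by
        have h := Nat.succ_div_of_dvd (a := (d + 1) * (N * k) - 1) (b := N * k) (by rwa [e])
        rw [e, Nat.mul_div_cancel _ hM] at h
        lia
      rw [e, if_pos hdvd, hdiv]
      exact ⟨by lia, by lia, by lia⟩
  rw [himage, card_image_of_injOn, card_range]
  intro a _ b _ hab
  have ha : 0 < (a + 1) * (N * k) := by positivity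
  have hb : 0 < (b + 1) * (N * k) := by positivity
  have hab : (a + 1) * (N * k) = (b + 1) * (N * k) := by
    have : (a + 1) * (N * k) - 1 = (b + 1) * (N * k) - 1 := hab
    lia
  have := Nat.eq_of_mul_eq_mul_right hM hab
  lia

lemma killingPlay_alive_congr {ε ε' : ℕ → Bool} {t : ℕ} (h : ∀ s < t, ε s = ε' s) :
    (killingPlay N hpick code hm D ε).alive t = (killingPlay N hpick code hm D ε').alive t := by
  refine aliveOn_congr pick N fun s hs => h s (hs.trans_le ?_)
  calc min (t / N / k) m * k * N ≤ t / N / k * k * N := by gcongr; exact min_le_left _ _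
    _ ≤ t / N * N := by gcongr; exact Nat.div_mul_le_self _ _
    _ ≤ t := Nat.div_mul_le_self _ _

lemma killingPlay_history_congr {ε ε' : ℕ → Bool} {t : ℕ} (h : ∀ s < t, ε s = ε' s) :
    (killingPlay N hpick code hm D ε).history t =
      (killingPlay N hpick code hm D ε').history t := by
  refine List.map_congr_left fun s hs => ?_
  have hs := List.mem_range.1 hs
  have ha := killingPlay_alive_congr N hpick code hm D fun r hr => h r (hr.trans hs)
  refine Prod.ext ha ?_
  funext i
  simp only [killingPlay] at ha ⊢
  rw [ha, h s hs]

/-- Learner's probability of the bit `true` minus that of the bit `false` in round `t`. -/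
def advantage (S : Strategy K) (t : ℕ) (ε : ℕ → Bool) : ℝ :=
  ∑ i, S.predict ((killingPlay N hpick code hm D ε).history t)
    ((killingPlay N hpick code hm D ε).alive t) i *
      sgn (code ((killingPlay N hpick code hm D ε).alive t) i (t / N % k))

lemma advantage_congr (S : Strategy K) (t : ℕ) (ε ε' : ℕ → Bool) (h : ∀ s < t, ε s = ε' s) :
    advantage N hpick code hm D S t ε = advantage N hpick code hm D S t ε' := by
  unfold advantage
  rw [killingPlay_history_congr N hpick code hm D h, killingPlay_alive_congr N hpick code hm D h]

lemma Strategy.roundLoss_nonneg (S : Strategy K) (P : Play K) (t : ℕ) : 0 ≤ S.roundLoss P t :=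
  sum_nonneg fun i _ => mul_nonneg ((S.predict_mem _ _ (P.alive_nonempty t)).1 i)
    (P.loss_mem t i).1

lemma roundLoss_killingPlay (S : Strategy K) (ε : ℕ → Bool) {t : ℕ} (ht : t < D * k * N) :
    S.roundLoss (killingPlay N hpick code hm D ε) t =
      1 / 2 + 1 / 2 * (sgn (ε t) * advantage N hpick code hm D S t ε) := by
  set P := killingPlay N hpick code hm D ε with hP
  have hloss : ∀ i, P.loss t i =
      1 / 2 + 1 / 2 * (sgn (code (P.alive t) i (t / N % k)) * sgn (ε t)) := fun i => by
    rw [← ite_eq_eq_sgn]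
    simp only [hP, killingPlay, if_pos ht]
  have hsum : ∑ i, S.predict (P.history t) (P.alive t) i = 1 :=
    (S.predict_mem _ _ (P.alive_nonempty t)).2
  simp only [Strategy.roundLoss, hloss, mul_add, sum_add_distrib, ← sum_mul, hsum, advantage,
    ← hP, mul_sum]
  rw [one_mul]
  congr 1
  exact sum_congr rfl fun i _ => by ring

/-- The ordering by time of death has, in each block, half the modulus of the sum of the signs as
its gain over the average loss. -/
lemma exists_orderingLoss_killingPlay (hk : 0 < k) (hN : 0 < N)
    (hcode : ∀ A w, 2 ^ k ≤ #A → ∀ j : Fin k, code A (pick A w) j = w j)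
    (hD : 2 ^ k + D ≤ K + 1) (hDm : D ≤ m) {T : ℕ} (hT : D * k * N ≤ T) (ε : ℕ → Bool) :
    ∃ π, (killingPlay N hpick code hm D ε).orderingLoss T π =
      (D * k * N : ℕ) / 2 - 1 / 2 *
        ∑ b ∈ range (D * k), |∑ r ∈ range N, sgn (ε (b * N + r))| := by
  obtain ⟨π, hπ⟩ := exists_ordering N hpick ε
  refine ⟨π, ?_⟩
  set P := killingPlay N hpick code hm D ε with hP
  have hblock : ∀ b ∈ range (D * k), ∑ r ∈ range N,
      P.loss (b * N + r) (firstAlive π (P.alive (b * N + r)) (P.alive_nonempty _)) =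
        N / 2 - 1 / 2 * |∑ r ∈ range N, sgn (ε (b * N + r))| := by
    intro b hb
    have hb := mem_range.1 hb
    have hd : b / k < D := (Nat.div_lt_iff_lt_mul hk).2 hb
    have hmod : b % k < k := Nat.mod_lt _ hk
    have hcard : 2 ^ k ≤ #(aliveOn pick N ε (b / k)) := by
      rw [card_aliveOn N hpick ε (by lia)]
      lia
    have hbit := hcode _ (leaderCode k N ε (b / k)) hcard ⟨b % k, hmod⟩
    have hloss : ∀ r ∈ range N,
        P.loss (b * N + r) (firstAlive π (P.alive (b * N + r)) (P.alive_nonempty _)) =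
          1 / 2 + 1 / 2 * (sgn (leaderCode k N ε (b / k) ⟨b % k, hmod⟩) *
            sgn (ε (b * N + r))) := by
      intro r hr
      have hr := mem_range.1 hr
      have hdiv : (b * N + r) / N = b := by
        rw [mul_comm, Nat.mul_add_div hN, Nat.div_eq_of_lt hr, add_zero]
      have hmin : min ((b * N + r) / N / k) m = b / k := by rw [hdiv]; lia
      have hlt : b * N + r < D * k * N := by
        have := Nat.mul_le_mul_right N (Nat.succ_le_of_lt hb)
        rw [Nat.succ_mul] at this
        lia
      have hfirst : firstAlive π (P.alive (b * N + r)) (P.alive_nonempty _) =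
          leader pick N ε (b / k) := by
        simp only [hP, killingPlay, hmin]
        exact hπ _ (by lia) _
      rw [hfirst, ← ite_eq_eq_sgn]
      simp only [hP, killingPlay, if_pos hlt, hmin, leader]
      rw [hdiv, hbit]
    rw [sum_congr rfl hloss, sum_add_distrib, ← mul_sum, ← mul_sum, sum_const, card_range,
      nsmul_eq_mul]
    have hindex : b / k * k + b % k = b := Nat.div_add_mod' b k
    simp only [leaderCode, hindex]
    by_cases h : ∑ r ∈ range N, sgn (ε (b * N + r)) < 0
    · rw [abs_of_neg h, decide_eq_true h]
      simp only [sgn, if_true]; ring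
    · rw [abs_of_nonneg (not_lt.1 h), decide_eq_false h]
      simp only [sgn, Bool.false_eq_true, if_false]; ring
  have hlate : ∀ r ∈ range (T - D * k * N), P.loss (D * k * N + r)
      (firstAlive π (P.alive (D * k * N + r)) (P.alive_nonempty _)) = 0 := by
    intro r _
    simp only [hP, killingPlay]
    rw [if_neg (by lia)]
  rw [Play.orderingLoss, ← Nat.add_sub_cancel' hT, sum_range_add, sum_congr rfl hlate,
    sum_const_zero, add_zero, sum_range_mul_eq, sum_congr rfl hblock, sum_sub_distrib,
    ← mul_sum, sum_const, card_range, nsmul_eq_mul]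
  push_cast
  ring

end Killing

/-- Every set of at least `2 ^ k` experts can be labelled with codes such that all codes of `k` bits
occur. -/
lemma exists_code_pick {K : ℕ} (hK : 0 < K) (k : ℕ) :
    ∃ (code : Finset (Fin K) → Fin K → ℕ → Bool) (pick : Finset (Fin K) → (Fin k → Bool) → Fin K),
      (∀ A w, A.Nonempty → pick A w ∈ A) ∧
        ∀ A w, 2 ^ k ≤ #A → ∀ j : Fin k, code A (pick A w) j = w j := by
  have key : ∀ A : Finset (Fin K), ∃ (c : Fin K → ℕ → Bool) (p : (Fin k → Bool) → Fin K),
      (∀ w, A.Nonempty → p w ∈ A) ∧ ∀ w, 2 ^ k ≤ #A → ∀ j : Fin k, c (p w) j = w j := by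
    intro A
    by_cases hA : 2 ^ k ≤ #A
    · obtain ⟨f⟩ := Function.Embedding.nonempty_of_card_le (α := Fin k → Bool) (β := A)
        (by simpa using hA)
      have hf : Function.Injective fun w => (f w : Fin K) :=
        Subtype.val_injective.comp f.injective
      refine ⟨fun i j => if h : j < k then Function.invFun (fun w => (f w : Fin K)) i ⟨j, h⟩
        else false, fun w => f w, fun w _ => (f w).2, fun w _ j => ?_⟩
      beta_reduce
      rw [dif_pos j.2, Function.leftInverse_invFun hf w]
    · rcases A.eq_empty_or_nonempty with rfl | ⟨a, ha⟩
      · exact ⟨fun _ _ => false, fun _ => ⟨0, hK⟩, fun _ h => absurd h not_nonempty_empty,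
          fun _ h => absurd h hA⟩
      · exact ⟨fun _ _ => false, fun _ => a, fun _ _ => ha, fun _ h => absurd h hA⟩
  choose c p h1 h2 using key
  exact ⟨c, p, h1, h2⟩

/-- Against every strategy, some play with exactly `m` nights has regret of order `√N` in each of
the `k` blocks of each of the first `D` days. -/
theorem exists_play_rankingRegret_ge {K T m D k N : ℕ} (hm : m < K) (hDm : D ≤ m) (hk : 0 < k)
    (hN : 0 < N) (hD : 2 ^ k + D ≤ K + 1) (hT : m * (k * N) < T) (S : Strategy K) :
    ∃ P : Play K, #(P.nights T) = m ∧ 9 / 32 * (D * k * √N) ≤ rankingRegret S P T := by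
  obtain ⟨code, pick, hpick, hcode⟩ := exists_code_pick (by lia : 0 < K) k
  obtain ⟨ε, hε⟩ := exists_signs (advantage N hpick code hm D S)
    (advantage_congr N hpick code hm D S) hN (D * k)
  have hL : D * k * N ≤ T := by
    rw [mul_assoc]
    exact (Nat.mul_le_mul_right _ hDm).trans hT.le
  refine ⟨_, card_nights_killingPlay N hpick code hm D hk hN hT ε, ?_⟩
  obtain ⟨π, hπ⟩ := exists_orderingLoss_killingPlay N hpick code hm D hk hN hcode hD hDm hL ε
  set P := killingPlay N hpick code hm D ε
  have hbest : (univ : Finset (Equiv.Perm (Fin K))).inf' univ_nonempty (P.orderingLoss T) ≤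
      P.orderingLoss T π := inf'_le _ (mem_univ π)
  have hlearner : ∑ t ∈ range (D * k * N), S.roundLoss P t ≤ ∑ t ∈ range T, S.roundLoss P t :=
    sum_le_sum_of_subset_of_nonneg (range_subset_range.2 hL) fun t _ _ =>
      Strategy.roundLoss_nonneg S P t
  rw [sum_congr rfl fun t ht => roundLoss_killingPlay N hpick code hm D S ε (mem_range.1 ht),
    sum_add_distrib, ← mul_sum, sum_const, card_range, nsmul_eq_mul] at hlearner
  unfold rankingRegret
  push_cast at hε hlearner hπ
  linarith

theorem le_minimaxRankingRegret {K T m D k N : ℕ} (hm : m < K) (hDm : D ≤ m) (hk : 0 < k)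
    (hN : 0 < N) (hD : 2 ^ k + D ≤ K + 1) (hT : m * (k * N) < T) {x : ℝ}
    (hx : x ≤ 9 / 32 * (D * k * √N)) : (x : EReal) ≤ minimaxRankingRegret K T m := by
  refine le_iInf fun S => ?_
  obtain ⟨P, hP, hreg⟩ := exists_play_rankingRegret_ge hm hDm hk hN hD hT S
  exact le_iSup_of_le ⟨P, hP⟩ (EReal.coe_le_coe_iff.2 (hx.trans hreg))

/-! ### The choice of the parameters -/

lemma log_le_three_mul_natLog {K n : ℕ} (hn : 2 ≤ n) (hK : K ≤ 2 * n) :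
    Real.log K ≤ 3 * Nat.log 2 n := by
  have hlog : 1 ≤ Nat.log 2 n := Nat.log_pos (by norm_num) hn
  rcases Nat.eq_zero_or_pos K with rfl | hK0
  · simp
  have hlt : K ≤ 2 ^ (3 * Nat.log 2 n) := by
    calc K ≤ 2 * n := hK
      _ ≤ 2 * 2 ^ (Nat.log 2 n + 1) := by
        gcongr
        exact (Nat.lt_pow_succ_log_self (by norm_num) n).le
      _ = 2 ^ (Nat.log 2 n + 2) := by ring
      _ ≤ 2 ^ (3 * Nat.log 2 n) := Nat.pow_le_pow_right (by norm_num) (by lia)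
  have h2 : Real.log K ≤ Real.log ((2 : ℝ) ^ (3 * Nat.log 2 n)) :=
    Real.log_le_log (by exact_mod_cast hK0) (by exact_mod_cast hlt)
  rw [Real.log_pow] at h2
  push_cast at h2
  have := Real.log_two_lt_d9
  have : (1 : ℝ) ≤ Nat.log 2 n := by exact_mod_cast hlog
  nlinarith

/-- Half of the days are used, so that at least half of the experts are alive on each of them. If
the day length `q` is at most about `log K`, then every round is a block of its own; otherwise a day
has about `log K` blocks. -/
theorem min_le_minimaxRankingRegret {K T m : ℕ} (hK : m + 1 ≤ K) (hT : m + 1 ≤ T) :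
    ((1 / 64 * min √(m * T * Real.log K) T : ℝ) : EReal) ≤ minimaxRankingRegret K T m := by
  rcases Nat.eq_zero_or_pos m with rfl | hm
  · refine le_minimaxRankingRegret (D := 0) (k := 1) (N := 1) hK le_rfl one_pos one_pos
      (by lia) (by lia) ?_
    simp
  set D := (m + 1) / 2 with hD
  set n := K + 1 - D with hn
  set q := T / (m + 1) with hq
  have hn2 : 2 ≤ n := by lia
  have hlogpos : 0 < Nat.log 2 n := Nat.log_pos (by norm_num) hn2
  have hq1 : 1 ≤ q := (Nat.one_le_div_iff (by lia)).2 hT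
  have hqT : q * (m + 1) ≤ T := Nat.div_mul_le_self _ _
  have hpow : 2 ^ Nat.log 2 n ≤ n := Nat.pow_log_le_self 2 (by lia)
  have hTq : T ≤ 4 * (q * m) := by
    have h : T < (q + 1) * (m + 1) := by
      rw [add_mul, one_mul]; exact Nat.lt_div_mul_add (by lia)
    nlinarith
  have hDm : (m : ℝ) ≤ 2 * D := by exact_mod_cast (by lia : m ≤ 2 * D)
  have hTq' : (T : ℝ) ≤ 4 * (q * m) := by exact_mod_cast hTq
  rcases le_or_gt q (Nat.log 2 n) with hcase | hcase
  · have hpow' : 2 ^ q ≤ n := (Nat.pow_le_pow_right (by norm_num) hcase).trans hpow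
    refine le_minimaxRankingRegret (D := D) (k := q) (N := 1) hK (by lia) hq1 one_pos
      (by lia) (by nlinarith) ?_
    have h := min_le_right √(m * T * Real.log K) (T : ℝ)
    have h2 : (q : ℝ) * m ≤ q * (2 * D) := by gcongr
    simp only [Nat.cast_one, Real.sqrt_one]
    have : (0 : ℝ) ≤ q * D := by positivity
    linarith
  · set k := Nat.log 2 n with hk
    set N := q / k with hN
    have hN1 : 1 ≤ N := (Nat.one_le_div_iff hlogpos).2 hcase.le
    have hNq : N * k ≤ q := Nat.div_mul_le_self _ _
    have hqN : q ≤ 2 * (N * k) := by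
      have h : q < N * k + k := Nat.lt_div_mul_add hlogpos
      nlinarith
    refine le_minimaxRankingRegret (D := D) (k := k) (N := N) hK (by lia) hlogpos hN1
      (by lia) (by nlinarith) ?_
    have hlogK : Real.log K ≤ 3 * k := log_le_three_mul_natLog hn2 (by lia)
    have hlog0 : 0 ≤ Real.log K := Real.log_natCast_nonneg K
    have hqN' : (q : ℝ) ≤ 2 * (N * k) := by exact_mod_cast hqN
    have hbound : (m : ℝ) * T * Real.log K ≤ 96 * (D * k) ^ 2 * N := by
      calc (m : ℝ) * T * Real.log K ≤ m * (4 * (2 * (N * k) * m)) * (3 * k) := by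
            gcongr
            exact hTq'.trans (by gcongr)
        _ = 24 * m ^ 2 * k ^ 2 * N := by ring
        _ ≤ 24 * (2 * D) ^ 2 * k ^ 2 * N := by gcongr
        _ = 96 * (D * k) ^ 2 * N := by ring
    have hsqrt : √(m * T * Real.log K) ≤ 10 * (D * k * √N) := by
      refine Real.sqrt_le_iff.2 ⟨by positivity, hbound.trans ?_⟩
      rw [mul_pow 10, mul_pow _ √(N : ℝ), Real.sq_sqrt (Nat.cast_nonneg _)]
      nlinarith [show (0 : ℝ) ≤ (D * k) ^ 2 * N by positivity]
    have h := min_le_left √(m * T * Real.log K) (T : ℝ)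
    have : (0 : ℝ) ≤ D * k * √N := by positivity
    linarith

end

end DyingExperts

theorem theorem4 :
    ∃ c : ℝ, 0 < c ∧ ∀ K T m : ℕ, m + 1 ≤ K → m + 1 ≤ T →
      (((c * min √(m * T * Real.log K) T : ℝ) : EReal) ≤
        DyingExperts.minimaxRankingRegret K T m) ∧
      (√((T / (m + 1) : ℝ) / 2 * Real.log K) < (T / (m + 1) : ℝ) →
        ((c * √(m * T * Real.log K) : ℝ) : EReal) ≤
          DyingExperts.minimaxRankingRegret K T m) := by
  refine ⟨1 / 128, by norm_num, fun K T m hK hT => ?_⟩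
  have hmain := DyingExperts.min_le_minimaxRankingRegret hK hT
  have hmin : 0 ≤ min √(m * T * Real.log K) (T : ℝ) := by positivity
  refine ⟨le_trans (EReal.coe_le_coe_iff.2 (by linarith)) hmain, fun h => ?_⟩
  have hT0 : (0 : ℝ) < T := by exact_mod_cast (by lia : 0 < T)
  have hm0 : (0 : ℝ) < m + 1 := by positivity
  have hday : 0 < (T : ℝ) / (m + 1) := by positivity
  have hlog : Real.log K < 2 * (T / (m + 1)) := by
    have := (Real.sqrt_lt' hday).1 h
    nlinarith
  have hsqrt : √(m * T * Real.log K) ≤ 2 * T := by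
    refine Real.sqrt_le_iff.2 ⟨by positivity, ?_⟩
    calc (m : ℝ) * T * Real.log K ≤ (m + 1) * T * (2 * (T / (m + 1))) := by
          gcongr
          linarith
      _ = 2 * T ^ 2 := by field_simp
      _ ≤ (2 * T) ^ 2 := by nlinarith
  refine le_trans (EReal.coe_le_coe_iff.2 ?_) hmain
  have : √(m * T * Real.log K) / 2 ≤ min √(m * T * Real.log K) (T : ℝ) :=
    le_min (by linarith [Real.sqrt_nonneg (m * T * Real.log K)]) (by linarith)
  linarith
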